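/- Let $G$ be a totally disconnected locally compact group. For $g \in G$ let $\alpha$ denote the inner automorphism $\alpha(x) = gxg^{-1}$ of $G$, and for a compact open subgroup $U$ of $G$ put $$U_+ = \bigcap_{n \ge 0} \alpha^n(U), \quad U_- = \bigcap_{n \ge 0} \alpha^{-n}(U), \quad U_{++} = \bigcup_{n \ge 0} \alpha^n(U_+), \quad U_{--} = \bigcup_{n \ge 0} \alpha^{-n}(U_-).$$ The subgroup $U$ is called tidy above for $g$ if $|\alpha(U_+) : U_+| = |\alpha(U) : \alpha(U) \cap U|$, tidy below for $g$ if $U_{++}$ and $U_{--}$ are closed in $G$, and tidy for $g$ if it is both tidy above and tidy below for $g$. Then for every $g \in G$ there exists a compact open subgroup $U$ of $G$ that is tidy for $g$. -/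

import Mathlib

namespace Tidy

/-- `U₊ = ⋂_{n ≥ 0} αⁿ(U)`. -/
def plus {G : Type*} [Group G] (α : MulAut G) (U : Subgroup G) : Subgroup G :=
  ⨅ n : ℕ, U.map (α ^ n).toMonoidHom

/-- `U₋ = ⋂_{n ≥ 0} α⁻ⁿ(U)`. -/
def minus {G : Type*} [Group G] (α : MulAut G) (U : Subgroup G) : Subgroup G :=
  ⨅ n : ℕ, U.map (α ^ (-(n : ℤ))).toMonoidHom

/-- `U₊₊ = ⋃_{n ≥ 0} αⁿ(U₊)`. -/
def plusPlus {G : Type*} [Group G] (α : MulAut G) (U : Subgroup G) : Set G :=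
  ⋃ n : ℕ, ((plus α U).map (α ^ n).toMonoidHom : Set G)

/-- `U₋₋ = ⋃_{n ≥ 0} α⁻ⁿ(U₋)`. -/
def minusMinus {G : Type*} [Group G] (α : MulAut G) (U : Subgroup G) : Set G :=
  ⋃ n : ℕ, ((minus α U).map (α ^ (-(n : ℤ))).toMonoidHom : Set G)

/-- `U` is tidy above for `α`: `|α(U₊) : U₊| = |α(U) : α(U) ∩ U|`. Here `H.relIndex K` is the
index `|K : H ∩ K|`, and `U₊ ≤ α(U₊)`. Both indices are finite when `U` is compact open and `α`
is bicontinuous. -/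
def IsTidyAbove {G : Type*} [Group G] (α : MulAut G) (U : Subgroup G) : Prop :=
  (plus α U).relIndex ((plus α U).map α.toMonoidHom) =
    (U.map α.toMonoidHom ⊓ U).relIndex (U.map α.toMonoidHom)

/-- `U` is tidy below for `α`: `U₊₊` and `U₋₋` are closed. -/
def IsTidyBelow {G : Type*} [Group G] [TopologicalSpace G] (α : MulAut G)
    (U : Subgroup G) : Prop :=
  IsClosed (plusPlus α U) ∧ IsClosed (minusMinus α U)

/-- `U` is a compact open subgroup that is tidy (above and below) for `α`. -/
structure IsTidy {G : Type*} [Group G] [TopologicalSpace G] (α : MulAut G)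
    (U : Subgroup G) : Prop where
  isCompact : IsCompact (U : Set G)
  isOpen : IsOpen (U : Set G)
  tidyAbove : IsTidyAbove α U
  tidyBelow : IsTidyBelow α U

end Tidy

/-!
Tidy subgroups exist for every automorphism `α` of a totally disconnected locally compact group
all of whose integer powers are continuous. Since `U₋` and `U₋₋` for `α` are `U₊` and `U₊₊` for
`α⁻¹`, every statement is proved for `+` only and then applied to both `α` and `α⁻¹`.

For a compact open subgroup `U`, let `L` be the closure of the homoclinic group
`U₊₊ ∩ U₋₋ = {x | αⁿ(x) ∈ U for all but finitely many n ∈ ℤ}`. It is an `α`-invariant subgroup,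
and it is compact: since `α(U₊)/U₊` is finite, the homoclinic group lies in `U₋ αᴺ(U₊)` for
some `N` (`exists_homoclinic_subset_mul`).

By van Dantzig's theorem there is a compact open subgroup `U`. Its subgroup
`U' = ⋂_{l ∈ L} l⁻¹Ul` is open because `L` is compact, and for large `n` the subgroup
`W = ⋂_{0 ≤ k ≤ n} αᵏ(U')` satisfies `W = W₊W₋` (`exists_factorizes_truncation`). As `L` is
`α`-invariant, it still normalizes `W`; hence so does the closure `M` of `W₊₊ ∩ W₋₋`, which is
contained in `L`.

The subgroup `V = MW` is tidy. The main point is that an element of `W₊₊ ∩ V` already lies in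
`(W₊₊ ∩ W₋₋)W₊` (`exists_mul_eq_of_mem_expanding`): modulo `W` an element of `M` may be replaced by
a homoclinic one, so that `x = l b a` with `l` homoclinic, `b ∈ W₋`, `a ∈ W₊`, and then
`l b = x a⁻¹` lies in `W₊₊ ∩ W₋₋`. Applied to `α⁻¹`, this yields `V₊ = MW₊`
(`exists_mul_eq_of_mem_plus_enlargement`), and applied again to `α` it yields `V₊₊ ∩ V = V₊`.
The latter forces `V₊₊` to be closed, because a subgroup whose intersection with an open subgroup
is closed is itself closed. Tidiness above follows from `V = V₊V₋`, which is inherited from `W`.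
-/

open Filter Topology Set
open scoped Pointwise

namespace Tidy

/-! ### Iterates of an automorphism and the subgroups they define -/

section Algebra

variable {G : Type*} [Group G] {α : MulAut G} {U : Subgroup G} {x : G}

theorem zpow_zpow_apply (α : MulAut G) (m n : ℤ) (x : G) :
    (α ^ m) ((α ^ n) x) = (α ^ (m + n)) x := by
  rw [zpow_add, MulAut.mul_apply]

theorem mem_map_zpow {n : ℤ} :
    x ∈ U.map (α ^ n).toMonoidHom ↔ (α ^ (-n)) x ∈ U := by
  constructor
  · rintro ⟨y, hy, rfl⟩
    have : (α ^ (-n)) ((α ^ n) y) = y := by simp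
    exact this.symm ▸ hy
  · intro h
    exact ⟨_, h, show (α ^ n) ((α ^ (-n)) x) = x by simp⟩

theorem mem_map_pow {n : ℕ} :
    x ∈ U.map (α ^ n).toMonoidHom ↔ (α ^ (-(n : ℤ))) x ∈ U := by
  rw [← mem_map_zpow, zpow_natCast]

theorem mem_map_self : x ∈ U.map α.toMonoidHom ↔ (α ^ (-1 : ℤ)) x ∈ U := by
  rw [← mem_map_zpow, zpow_one]

theorem mem_plus : x ∈ plus α U ↔ ∀ n : ℕ, (α ^ (-(n : ℤ))) x ∈ U := by
  simp only [plus, Subgroup.mem_iInf, mem_map_pow]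

theorem mem_plus_inv : x ∈ plus α⁻¹ U ↔ ∀ n : ℕ, (α ^ (n : ℤ)) x ∈ U := by
  simp only [mem_plus, inv_zpow', neg_neg]

theorem minus_eq_plus_inv (α : MulAut G) (U : Subgroup G) : minus α U = plus α⁻¹ U := by
  ext x
  simp only [minus, Subgroup.mem_iInf, mem_map_zpow, mem_plus_inv, neg_neg]

theorem minusMinus_eq_plusPlus_inv (α : MulAut G) (U : Subgroup G) :
    minusMinus α U = plusPlus α⁻¹ U := by
  simp only [minusMinus, plusPlus, minus_eq_plus_inv, ← zpow_natCast, inv_zpow']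

theorem plus_le (α : MulAut G) (U : Subgroup G) : plus α U ≤ U := fun x hx => by
  simpa using mem_plus.1 hx 0

theorem zpow_neg_apply_mem_plus (hx : x ∈ plus α U) (k : ℕ) :
    (α ^ (-(k : ℤ))) x ∈ plus α U := by
  refine mem_plus.2 fun n => ?_
  have := mem_plus.1 hx (n + k)
  rw [zpow_zpow_apply]
  convert this using 3
  push_cast; ring

theorem zpow_apply_mem_plus_inv (hx : x ∈ plus α⁻¹ U) (k : ℕ) :
    (α ^ (k : ℤ)) x ∈ plus α⁻¹ U := by
  simpa only [inv_zpow', neg_neg] using zpow_neg_apply_mem_plus hx k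

/-- The inclusion `U ∩ α(U₊) ⊆ U₊`. -/
theorem mem_plus_of_mem_of_apply (hx : x ∈ U) (h : (α ^ (-1 : ℤ)) x ∈ plus α U) :
    x ∈ plus α U := by
  refine mem_plus.2 fun n => ?_
  cases n with
  | zero => simpa using hx
  | succ n =>
    have := mem_plus.1 h n
    rw [zpow_zpow_apply] at this
    rwa [show (-((n + 1 : ℕ) : ℤ)) = -(n : ℤ) + -1 by push_cast; ring]

theorem plus_mono {V : Subgroup G} (h : U ≤ V) : plus α U ≤ plus α V := fun _ hx =>
  mem_plus.2 fun n => h (mem_plus.1 hx n)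

/-- The increasing union `U₊₊` as a subgroup: the elements whose backward orbit under `α`
eventually stays in `U`. -/
def expanding (α : MulAut G) (U : Subgroup G) : Subgroup G where
  carrier := {x | ∀ᶠ n : ℤ in atTop, (α ^ (-n)) x ∈ U}
  one_mem' := by simp
  mul_mem' {x y} hx hy := by
    filter_upwards [hx, hy] with n h1 h2
    rw [map_mul]; exact mul_mem h1 h2
  inv_mem' {x} hx := by
    filter_upwards [hx] with n h1
    rw [map_inv]; exact inv_mem h1

theorem mem_expanding : x ∈ expanding α U ↔ ∀ᶠ n : ℤ in atTop, (α ^ (-n)) x ∈ U := Iff.rfl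

theorem mem_expanding_iff_exists_plus :
    x ∈ expanding α U ↔ ∃ n : ℕ, (α ^ (-(n : ℤ))) x ∈ plus α U := by
  simp only [mem_expanding, eventually_atTop, mem_plus, zpow_zpow_apply]
  constructor
  · rintro ⟨N, hN⟩
    refine ⟨N.toNat, fun n => ?_⟩
    rw [← neg_add]
    exact hN _ (by omega)
  · rintro ⟨n, hn⟩
    refine ⟨n, fun m hm => ?_⟩
    have := hn (m - n).toNat
    rwa [show -((m - n).toNat : ℤ) + -(n : ℤ) = -m by omega] at this

theorem coe_expanding (α : MulAut G) (U : Subgroup G) :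
    (expanding α U : Set G) = plusPlus α U := by
  ext x
  simp only [plusPlus, mem_iUnion, SetLike.mem_coe, mem_map_pow, mem_expanding_iff_exists_plus]

theorem expanding_mono {V : Subgroup G} (h : U ≤ V) : expanding α U ≤ expanding α V :=
  fun _ hx => Eventually.mono (mem_expanding.1 hx) fun _ hn => h hn

theorem plus_le_expanding (α : MulAut G) (U : Subgroup G) : plus α U ≤ expanding α U :=
  fun x hx => mem_expanding_iff_exists_plus.2 ⟨0, by simpa using hx⟩

theorem zpow_apply_mem_expanding (hx : x ∈ expanding α U) (k : ℤ) :
    (α ^ k) x ∈ expanding α U := by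
  have := (tendsto_atTop_add_const_right atTop (-k) tendsto_id).eventually (mem_expanding.1 hx)
  refine mem_expanding.2 (this.mono fun n hn => ?_)
  rw [zpow_zpow_apply]
  simpa [add_comm] using hn

/-- The subgroup `U₊₊ ∩ U₋₋` of the elements `x` with `αⁿ(x) ∈ U` for all but finitely many
integers `n`. -/
def homoclinic (α : MulAut G) (U : Subgroup G) : Subgroup G :=
  expanding α U ⊓ expanding α⁻¹ U

theorem homoclinic_inv (α : MulAut G) (U : Subgroup G) :
    homoclinic α⁻¹ U = homoclinic α U := by
  rw [homoclinic, homoclinic, inv_inv, inf_comm]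

theorem homoclinic_mono {V : Subgroup G} (h : U ≤ V) : homoclinic α U ≤ homoclinic α V :=
  inf_le_inf (expanding_mono h) (expanding_mono h)

theorem zpow_apply_mem_homoclinic (hx : x ∈ homoclinic α U) (k : ℤ) :
    (α ^ k) x ∈ homoclinic α U := by
  have h2 := zpow_apply_mem_expanding hx.2 (-k)
  rw [inv_zpow', neg_neg] at h2
  exact ⟨zpow_apply_mem_expanding hx.1 k, h2⟩

/-- The finite intersection `⋂_{0 ≤ k ≤ n} αᵏ(U)`. -/
def truncation (α : MulAut G) (U : Subgroup G) (n : ℕ) : Subgroup G :=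
  ⨅ k : Fin (n + 1), U.map (α ^ (k : ℕ)).toMonoidHom

theorem mem_truncation {n : ℕ} :
    x ∈ truncation α U n ↔ ∀ k : ℕ, k ≤ n → (α ^ (-(k : ℤ))) x ∈ U := by
  simp only [truncation, Subgroup.mem_iInf, mem_map_pow]
  exact ⟨fun h k hk => h ⟨k, by omega⟩, fun h k => h k (by omega)⟩

theorem truncation_antitone (α : MulAut G) (U : Subgroup G) : Antitone (truncation α U) :=
  fun _ _ h _ hx => mem_truncation.2 fun k hk => mem_truncation.1 hx k (hk.trans h)

theorem truncation_le (α : MulAut G) (U : Subgroup G) (n : ℕ) : truncation α U n ≤ U :=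
  fun x hx => by simpa using mem_truncation.1 hx 0 (Nat.zero_le n)

theorem mem_plus_iff_truncation : x ∈ plus α U ↔ ∀ n, x ∈ truncation α U n :=
  ⟨fun h _ => mem_truncation.2 fun k _ => mem_plus.1 h k,
    fun h => mem_plus.2 fun n => mem_truncation.1 (h n) n le_rfl⟩

theorem plus_truncation (α : MulAut G) (U : Subgroup G) (n : ℕ) :
    plus α (truncation α U n) = plus α U := by
  refine le_antisymm (plus_mono (truncation_le α U n)) fun x hx => mem_plus.2 fun k => ?_
  exact mem_plus_iff_truncation.1 (zpow_neg_apply_mem_plus hx k) n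

/-! ### Tidiness above from `U = U₊U₋` -/

/-- The equality of sets `U = U₊U₋`. The reverse inclusion `U₊U₋ ⊆ U` always holds. -/
def Factorizes (α : MulAut G) (U : Subgroup G) : Prop :=
  ∀ x ∈ U, ∃ a ∈ plus α U, ∃ b ∈ plus α⁻¹ U, a * b = x

theorem Factorizes.inv (h : Factorizes α U) : Factorizes α⁻¹ U := fun x hx => by
  obtain ⟨a, ha, b, hb, hab⟩ := h x⁻¹ (inv_mem hx)
  refine ⟨b⁻¹, inv_mem hb, a⁻¹, by rw [inv_inv]; exact inv_mem ha, ?_⟩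
  rw [← mul_inv_rev, hab, inv_inv]

/-- If `K = A(K ∩ H)` with `A ≤ K`, then `A/(A ∩ H) → K/(K ∩ H)` is a bijection. -/
theorem relIndex_eq_of_factorization {A H K : Subgroup G} (hA : A ≤ K)
    (h : ∀ x ∈ K, ∃ a ∈ A, a⁻¹ * x ∈ H) : H.relIndex A = H.relIndex K := by
  let f := Subgroup.quotientSubgroupOfEmbeddingOfLE H hA
  refine Nat.card_congr (Equiv.ofBijective f ⟨f.injective, fun q => ?_⟩)
  induction q using QuotientGroup.induction_on with
  | _ x =>
    obtain ⟨a, ha, hax⟩ := h x x.2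
    refine ⟨QuotientGroup.mk ⟨a, ha⟩, ?_⟩
    rw [Subgroup.quotientSubgroupOfEmbeddingOfLE_apply_mk]
    exact QuotientGroup.eq.2 (Subgroup.mem_subgroupOf.2 hax)

theorem Factorizes.isTidyAbove (h : Factorizes α U) : IsTidyAbove α U := by
  have hsub : (plus α U).map α.toMonoidHom ≤ U.map α.toMonoidHom :=
    Subgroup.map_mono (plus_le α U)
  -- `α(U₊) ∩ U = U₊`, so both subgroups cut out the same cosets of `α(U₊)`.
  have key : (plus α U).relIndex ((plus α U).map α.toMonoidHom) =
      (U.map α.toMonoidHom ⊓ U).relIndex ((plus α U).map α.toMonoidHom) := by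
    rw [← Subgroup.inf_relIndex_right,
      ← Subgroup.inf_relIndex_right (U.map α.toMonoidHom ⊓ U)]
    congr 1
    ext x
    simp only [Subgroup.mem_inf, mem_map_self]
    constructor
    · rintro ⟨h1, h2⟩
      exact ⟨⟨plus_le _ _ h2, plus_le _ _ h1⟩, h2⟩
    · rintro ⟨⟨-, h1⟩, h2⟩
      exact ⟨mem_plus_of_mem_of_apply h1 h2, h2⟩
  rw [IsTidyAbove, key]
  refine relIndex_eq_of_factorization hsub fun x hx => ?_
  obtain ⟨y, hy, rfl⟩ := hx
  obtain ⟨a, ha, b, hb, rfl⟩ := h y hy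
  refine ⟨α a, ⟨a, ha, rfl⟩, ?_⟩
  have : (α a)⁻¹ * α.toMonoidHom (a * b) = α b := by simp
  rw [this]
  refine ⟨⟨b, plus_le _ _ hb, rfl⟩, ?_⟩
  simpa using mem_plus_inv.1 hb 1

end Algebra

/-! ### Topological properties of the orbit intersections -/

section Continuity

variable {G : Type*} [Group G] [TopologicalSpace G] {α : MulAut G} {U : Subgroup G}

theorem isClosed_map_zpow (hα : ∀ n : ℤ, Continuous (α ^ n)) (hU : IsClosed (U : Set G))
    (n : ℤ) : IsClosed ((U.map (α ^ n).toMonoidHom : Subgroup G) : Set G) := by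
  have : ((U.map (α ^ n).toMonoidHom : Subgroup G) : Set G) = (α ^ (-n)) ⁻¹' U := by
    ext x; exact mem_map_zpow
  rw [this]
  exact hU.preimage (hα _)

theorem isClosed_map_pow (hα : ∀ n : ℤ, Continuous (α ^ n)) (hU : IsClosed (U : Set G))
    (n : ℕ) : IsClosed ((U.map (α ^ n).toMonoidHom : Subgroup G) : Set G) := by
  simpa only [zpow_natCast] using isClosed_map_zpow hα hU n

theorem isClosed_plus (hα : ∀ n : ℤ, Continuous (α ^ n)) (hU : IsClosed (U : Set G)) :
    IsClosed (plus α U : Set G) := by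
  rw [plus, Subgroup.coe_iInf]
  exact isClosed_iInter (isClosed_map_pow hα hU)

theorem isClosed_truncation (hα : ∀ n : ℤ, Continuous (α ^ n)) (hU : IsClosed (U : Set G))
    (n : ℕ) : IsClosed (truncation α U n : Set G) := by
  rw [truncation, Subgroup.coe_iInf]
  exact isClosed_iInter fun k => isClosed_map_pow hα hU k

theorem isOpen_truncation (hα : ∀ n : ℤ, Continuous (α ^ n)) (hU : IsOpen (U : Set G))
    (n : ℕ) : IsOpen (truncation α U n : Set G) := by
  have : (truncation α U n : Set G) = ⋂ k : Fin (n + 1), (α ^ (-((k : ℕ) : ℤ))) ⁻¹' U := by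
    ext x
    simp only [truncation, SetLike.mem_coe, Subgroup.mem_iInf, mem_map_pow, mem_iInter, mem_preimage]
  rw [this]
  exact isOpen_iInter_of_finite fun k => hU.preimage (hα _)

theorem continuous_zpow_inv (hα : ∀ n : ℤ, Continuous (α ^ n)) (n : ℤ) :
    Continuous ((α⁻¹) ^ n) := by
  rw [inv_zpow']; exact hα _

theorem isCompact_plus (hα : ∀ n : ℤ, Continuous (α ^ n)) (hU : IsCompact (U : Set G))
    (hUc : IsClosed (U : Set G)) : IsCompact (plus α U : Set G) :=
  hU.of_isClosed_subset (isClosed_plus hα hUc) (plus_le α U)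

end Continuity

/-! ### Compactness and compact open subgroups -/

section Topology

variable {G : Type*} [Group G] [TopologicalSpace G] [IsTopologicalGroup G]
  {α : MulAut G} {U : Subgroup G}

/-- For a compact set `A`, `⋂ₙ A Cₙ = A ⋂ₙ Cₙ` for a decreasing sequence of closed
sets `Cₙ`. -/
theorem exists_mul_eq_of_antitone [T2Space G] {A : Set G} (hA : IsCompact A) {C : ℕ → Set G}
    (hC : Antitone C) (hCc : ∀ n, IsClosed (C n)) {x : G}
    (h : ∀ n, ∃ a ∈ A, ∃ c ∈ C n, a * c = x) :
    ∃ a ∈ A, ∃ c, (∀ n, c ∈ C n) ∧ a * c = x := by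
  have hcl : ∀ n, IsClosed {a : G | a⁻¹ * x ∈ C n} := fun n =>
    (hCc n).preimage (by fun_prop)
  obtain ⟨a, ha⟩ := IsCompact.nonempty_iInter_of_sequence_nonempty_isCompact_isClosed
    (fun n => A ∩ {a : G | a⁻¹ * x ∈ C n})
    (fun n => inter_subset_inter_right _ fun a ha => hC (Nat.le_succ n) ha)
    (fun n => by
      obtain ⟨a, ha, c, hc, rfl⟩ := h n
      exact ⟨a, ha, by simpa using hc⟩)
    (hA.inter_right (hcl 0)) (fun n => hA.isClosed.inter (hcl n))
  rw [mem_iInter] at ha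
  exact ⟨a, (ha 0).1, a⁻¹ * x, fun n => (ha n).2, mul_inv_cancel_left a x⟩

/-- Van Dantzig's theorem. For a compact open neighbourhood `K` of the identity, the subgroup
`{x | Kx = K}` is open and is contained in `K`. -/
theorem exists_compact_open_subgroup [LocallyCompactSpace G] [TotallyDisconnectedSpace G]
    [T2Space G] : ∃ U : Subgroup G, IsCompact (U : Set G) ∧ IsOpen (U : Set G) := by
  obtain ⟨C, hC, h1C⟩ := exists_compact_mem_nhds (1 : G)
  obtain ⟨K, hK, h1K, hKC⟩ :=
    loc_compact_Haus_tot_disc_of_zero_dim.mem_nhds_iff.1 h1C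
  have hKc : IsCompact K := hC.of_isClosed_subset hK.1 hKC
  let U : Subgroup G :=
    { carrier := {x | ∀ k ∈ K, k * x ∈ K ∧ k * x⁻¹ ∈ K}
      one_mem' := by simp
      mul_mem' := fun {x y} hx hy k hk => by
        refine ⟨?_, ?_⟩
        · rw [← mul_assoc]; exact (hy _ (hx k hk).1).1
        · rw [mul_inv_rev, ← mul_assoc]; exact (hx _ (hy k hk).2).2
      inv_mem' := fun {x} hx k hk => by
        rw [inv_inv]; exact (hx k hk).symm }
  have hUo : IsOpen (U : Set G) := by
    refine Subgroup.isOpen_of_mem_nhds U (g := 1) ?_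
    refine hKc.eventually_forall_of_forall_eventually fun k hk => ?_
    have h1 : ContinuousAt (fun z : G × G => z.2 * z.1) (1, k) := by fun_prop
    have h2 : ContinuousAt (fun z : G × G => z.2 * z.1⁻¹) (1, k) := by fun_prop
    exact (h1.eventually (hK.2.mem_nhds (by simpa using hk))).and
      (h2.eventually (hK.2.mem_nhds (by simpa using hk)))
  refine ⟨U, hKc.of_isClosed_subset (Subgroup.isClosed_of_isOpen U hUo) fun x hx => ?_, hUo⟩
  simpa using (hx 1 h1K).1

/-- A compact subgroup `L` normalizes an open subgroup of any given compact open subgroup `U`,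
namely `⋂_{l ∈ L} l⁻¹Ul`. -/
theorem exists_normalized_subgroup {L : Subgroup G} (hL : IsCompact (L : Set G))
    (hUc : IsCompact (U : Set G)) (hUo : IsOpen (U : Set G)) :
    ∃ V ≤ U, IsCompact (V : Set G) ∧ IsOpen (V : Set G) ∧
      ∀ l ∈ L, ∀ x ∈ V, l * x * l⁻¹ ∈ V := by
  let V : Subgroup G :=
    { carrier := {x | ∀ l ∈ L, l * x * l⁻¹ ∈ U}
      one_mem' := by simp
      mul_mem' := fun {x y} hx hy l hl => by
        have := mul_mem (hx l hl) (hy l hl)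
        rwa [conj_mul] at this
      inv_mem' := fun {x} hx l hl => by
        have := inv_mem (hx l hl)
        rwa [conj_inv] at this }
  have hVU : V ≤ U := fun x hx => by simpa using hx 1 (one_mem L)
  have hVo : IsOpen (V : Set G) := by
    refine Subgroup.isOpen_of_mem_nhds V (g := 1) ?_
    refine hL.eventually_forall_of_forall_eventually fun l hl => ?_
    have h1 : ContinuousAt (fun z : G × G => z.2 * z.1 * z.2⁻¹) (1, l) := by fun_prop
    exact h1.eventually (hUo.mem_nhds (by simp))
  refine ⟨V, hVU, hUc.of_isClosed_subset (Subgroup.isClosed_of_isOpen V hVo) hVU, hVo, ?_⟩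
  intro l hl x hx m hm
  have := hx (m * l) (mul_mem hm hl)
  simpa [mul_assoc] using this

/-! ### Compactness of the closure of the homoclinic group -/

section Homoclinic

variable [T2Space G]

/-- The cosets of `U₊` in `α(U₊)` that meet the homoclinic group are finite in number, so they have
homoclinic representatives whose forward orbits are in `U` from a common time `N` on. -/
theorem exists_homoclinic_representatives (hα : ∀ n : ℤ, Continuous (α ^ n))
    (hUc : IsCompact (U : Set G)) (hUo : IsOpen (U : Set G)) :
    ∃ N : ℕ, ∀ x ∈ homoclinic α U, (α ^ (-1 : ℤ)) x ∈ plus α U →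
      ∃ z ∈ homoclinic α U, (α ^ (N : ℤ)) z ∈ plus α⁻¹ U ∧ z⁻¹ * x ∈ plus α U := by
  have : DiscreteTopology (G ⧸ U) := QuotientGroup.discreteTopology hUo
  let S : Set G := {x | x ∈ homoclinic α U ∧ (α ^ (-1 : ℤ)) x ∈ plus α U}
  have hfin : ((QuotientGroup.mk : G → G ⧸ U) '' S).Finite := by
    have h := ((isCompact_plus hα hUc hUc.isClosed).image (hα 1)).image
      (QuotientGroup.continuous_mk (N := U))
    refine h.finite_of_discrete.subset (image_mono fun x hx => ⟨_, hx.2, by simp⟩)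
  -- As `αᴺ(z) ∈ U₋` persists when `N` grows, one `N` serves all cosets.
  have hev : ∀ q ∈ (QuotientGroup.mk : G → G ⧸ U) '' S, ∀ᶠ N : ℕ in atTop,
      ∃ z ∈ S, (α ^ (N : ℤ)) z ∈ plus α⁻¹ U ∧ (z : G ⧸ U) = q := by
    rintro _ ⟨z, hz, rfl⟩
    obtain ⟨n, hn⟩ := mem_expanding_iff_exists_plus.1 hz.1.2
    rw [inv_zpow', neg_neg] at hn
    filter_upwards [eventually_ge_atTop n] with N hN
    refine ⟨z, hz, ?_, rfl⟩
    have := zpow_apply_mem_plus_inv hn (N - n)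
    rwa [zpow_zpow_apply, show ((N - n : ℕ) : ℤ) + n = N by omega] at this
  obtain ⟨N, hN⟩ := ((eventually_all_finite hfin).2 hev).exists
  refine ⟨N, fun x hx hx' => ?_⟩
  obtain ⟨z, hz, hzN, hzx⟩ := hN _ ⟨x, ⟨hx, hx'⟩, rfl⟩
  refine ⟨z, hz.1, hzN, mem_plus_of_mem_of_apply (QuotientGroup.eq.1 hzx) ?_⟩
  rw [map_mul, map_inv]
  exact mul_mem (inv_mem hz.2) hx'

/-- The homoclinic group is contained in the compact set `U₋ αᴺ(U₊)`: an element of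
`αᴺ⁺ʲ(U₊)` is pushed down to `αᴺ(U₊)` by splitting off `j` factors from `U₋`. -/
theorem exists_homoclinic_subset_mul (hα : ∀ n : ℤ, Continuous (α ^ n))
    (hUc : IsCompact (U : Set G)) (hUo : IsOpen (U : Set G)) :
    ∃ N : ℕ, ∀ x ∈ homoclinic α U, ∃ b ∈ plus α⁻¹ U, ∃ a ∈ plus α U,
      b * (α ^ (N : ℤ)) a = x := by
  obtain ⟨N, hN⟩ := exists_homoclinic_representatives hα hUc hUo
  refine ⟨N, ?_⟩
  have key : ∀ j : ℕ, ∀ x ∈ homoclinic α U, (α ^ (-((N + j : ℕ) : ℤ))) x ∈ plus α U →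
      ∃ b ∈ plus α⁻¹ U, ∃ a ∈ plus α U, b * (α ^ (N : ℤ)) a = x := by
    intro j
    induction j with
    | zero =>
      intro x _ hx'
      exact ⟨1, one_mem _, _, hx', by simp⟩
    | succ j ih =>
      intro x hx hx'
      obtain ⟨z, hz, hzN, hzx⟩ := hN _ (zpow_apply_mem_homoclinic hx (-((N + j : ℕ) : ℤ))) (by
        rw [zpow_zpow_apply]
        convert hx' using 3
        push_cast; ring)
      set y := (α ^ ((N + j : ℕ) : ℤ)) z with hy
      have hy1 : y ∈ homoclinic α U := zpow_apply_mem_homoclinic hz _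
      have hy2 : y ∈ plus α⁻¹ U := by
        have := zpow_apply_mem_plus_inv hzN j
        rw [zpow_zpow_apply] at this
        rw [hy]
        convert this using 3
        push_cast; ring
      obtain ⟨b, hb, a, ha, hab⟩ := ih (y⁻¹ * x) (mul_mem (inv_mem hy1) hx) (by
        rw [map_mul, map_inv, hy, zpow_zpow_apply, neg_add_cancel]
        simpa using hzx)
      exact ⟨y * b, mul_mem hy2 hb, a, ha, by rw [mul_assoc, hab, mul_inv_cancel_left]⟩
  intro x hx
  obtain ⟨n, hn⟩ := mem_expanding_iff_exists_plus.1 hx.1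
  refine key n x hx ?_
  have := zpow_neg_apply_mem_plus hn N
  rw [zpow_zpow_apply] at this
  convert this using 3
  push_cast; ring

theorem isCompact_closure_homoclinic (hα : ∀ n : ℤ, Continuous (α ^ n))
    (hUc : IsCompact (U : Set G)) (hUo : IsOpen (U : Set G)) :
    IsCompact ((homoclinic α U).topologicalClosure : Set G) := by
  obtain ⟨N, hN⟩ := exists_homoclinic_subset_mul hα hUc hUo
  have h1 := isCompact_plus (continuous_zpow_inv hα) hUc hUc.isClosed
  have h2 := (isCompact_plus hα hUc hUc.isClosed).image (hα N)
  refine (h1.mul h2).closure_of_subset fun x hx => ?_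
  obtain ⟨b, hb, a, ha, rfl⟩ := hN x hx
  exact mul_mem_mul hb (mem_image_of_mem _ ha)

end Homoclinic

/-! ### Existence of a subgroup with `W = W₊W₋` -/

section Factorization

variable [T2Space G]

/-- The compact sets `⋂_{0 ≤ k ≤ n} αᵏ(U)` decrease to `U₊`, hence one of them lies in the open
set `U₊ α⁻¹(U)`. For this `n`, the second factor is moved by `α` into `⋂_{0 ≤ k ≤ n + 1} αᵏ(U)`. -/
theorem exists_truncation_subset_mul (hα : ∀ n : ℤ, Continuous (α ^ n))
    (hUc : IsCompact (U : Set G)) (hUo : IsOpen (U : Set G)) :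
    ∃ n, ∀ x ∈ truncation α U n, ∃ a ∈ plus α U, ∃ b ∈ truncation α U n,
      α b ∈ truncation α U n ∧ a * b = x := by
  have hcl := isClosed_truncation hα hUc.isClosed
  have hαc : Continuous α := by simpa using hα 1
  obtain ⟨n, hn⟩ := exists_subset_nhds_of_isCompact'
    (V := fun n => (truncation α U n : Set G)) (U := (plus α U : Set G) * (α ⁻¹' U))
    (directed_of_isDirected_le fun i j h => truncation_antitone α U h)
    (fun n => hUc.of_isClosed_subset (hcl n) (truncation_le α U n)) hcl
    (fun x hx => by
      refine (hUo.preimage hαc).mul_left.mem_nhds ?_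
      refine ⟨x, mem_plus_iff_truncation.2 fun n => mem_iInter.1 hx n, 1, ?_, mul_one x⟩
      simp)
  refine ⟨n, fun x hx => ?_⟩
  obtain ⟨a, ha, b, hb, rfl⟩ := hn hx
  have hbn : b ∈ truncation α U n := by
    have := mul_mem (inv_mem (mem_plus_iff_truncation.1 ha n)) hx
    simpa using this
  refine ⟨a, ha, b, hbn, mem_truncation.2 fun k hk => ?_, rfl⟩
  cases k with
  | zero => simpa using hb
  | succ k =>
    have h1 : α b = (α ^ (1 : ℤ)) b := by simp
    rw [h1, zpow_zpow_apply]
    convert mem_truncation.1 hbn k (by omega) using 3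
    push_cast; ring

/-- If `W = W₊(W ∩ α⁻¹(W))`, then iteration gives `W = W₊ ⋂_{0 ≤ k ≤ j} α⁻ᵏ(W)` for all `j`, and
compactness gives `W = W₊W₋`. -/
theorem factorizes_of_subset_mul {W : Subgroup G} (hα : ∀ n : ℤ, Continuous (α ^ n))
    (hWc : IsCompact (W : Set G))
    (h : ∀ x ∈ W, ∃ a ∈ plus α W, ∃ b ∈ W, α b ∈ W ∧ a * b = x) : Factorizes α W := by
  have key : ∀ j : ℕ, ∀ x ∈ W, ∃ a ∈ plus α W, ∃ b ∈ truncation α⁻¹ W j, a * b = x := by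
    intro j
    induction j with
    | zero =>
      intro x hx
      refine ⟨1, one_mem _, x, mem_truncation.2 fun k hk => ?_, one_mul x⟩
      obtain rfl : k = 0 := by omega
      simpa using hx
    | succ j ih =>
      intro x hx
      obtain ⟨a, ha, b, hb, rfl⟩ := ih x hx
      have hb' : ∀ k : ℕ, k ≤ j → (α ^ (k : ℤ)) b ∈ W := fun k hk => by
        simpa only [inv_zpow', neg_neg] using mem_truncation.1 hb k hk
      obtain ⟨c, hc, d, hd, hd', hcd⟩ := h _ (hb' j le_rfl)
      have hbcd : b = (α ^ (-(j : ℤ))) c * (α ^ (-(j : ℤ))) d := by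
        rw [← map_mul, hcd, zpow_zpow_apply, neg_add_cancel, zpow_zero, MulAut.one_apply]
      refine ⟨a * (α ^ (-(j : ℤ))) c, mul_mem ha (zpow_neg_apply_mem_plus hc j),
        (α ^ (-(j : ℤ))) d, mem_truncation.2 fun k hk => ?_, by rw [mul_assoc, ← hbcd]⟩
      rw [inv_zpow', neg_neg]
      rcases hk.lt_or_eq with hk | rfl
      · have h1 : (α ^ (k : ℤ)) ((α ^ (-(j : ℤ))) c) ∈ W := by
          have := mem_plus.1 hc (j - k)
          rw [zpow_zpow_apply]
          convert this using 3
          omega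
        have h2 := mul_mem (inv_mem h1) (hb' k (by omega))
        rwa [hbcd, map_mul, inv_mul_cancel_left] at h2
      · rw [zpow_zpow_apply, show ((j + 1 : ℕ) : ℤ) + -(j : ℤ) = 1 by push_cast; ring, zpow_one]
        exact hd'
  intro x hx
  have hα' := continuous_zpow_inv hα
  obtain ⟨a, ha, c, hc, rfl⟩ := exists_mul_eq_of_antitone (isCompact_plus hα hWc hWc.isClosed)
    (C := fun n => (truncation α⁻¹ W n : Set G)) (fun i j h => truncation_antitone α⁻¹ W h)
    (isClosed_truncation hα' hWc.isClosed) (fun n => key n x hx)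
  exact ⟨a, ha, c, mem_plus_iff_truncation.2 hc, rfl⟩

theorem exists_factorizes_truncation (hα : ∀ n : ℤ, Continuous (α ^ n))
    (hUc : IsCompact (U : Set G)) (hUo : IsOpen (U : Set G)) :
    ∃ n, Factorizes α (truncation α U n) := by
  obtain ⟨n, hn⟩ := exists_truncation_subset_mul hα hUc hUo
  refine ⟨n, factorizes_of_subset_mul hα
    (hUc.of_isClosed_subset (isClosed_truncation hα hUc.isClosed n) (truncation_le α U n)) ?_⟩
  rwa [plus_truncation]

end Factorization

/-! ### Enlarging by the closure of the homoclinic group -/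

section Enlargement

/-- The subgroup generated by `W` and the closure `L` of `W₊₊ ∩ W₋₋`; it is the product `LW`
when `L` normalizes `W`. -/
def enlargement (α : MulAut G) (W : Subgroup G) : Subgroup G :=
  (homoclinic α W).topologicalClosure ⊔ W

variable {W : Subgroup G} {x : G}

theorem enlargement_inv (α : MulAut G) (W : Subgroup G) :
    enlargement α⁻¹ W = enlargement α W := by
  rw [enlargement, enlargement, homoclinic_inv]

theorem coe_enlargement
    (hN : (homoclinic α W).topologicalClosure ≤ Subgroup.normalizer (W : Set G)) :
    (enlargement α W : Set G) = (homoclinic α W).topologicalClosure * W :=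
  Subgroup.coe_mul_of_left_le_normalizer_right _ _ hN

theorem zpow_apply_mem_closure_homoclinic (hα : ∀ n : ℤ, Continuous (α ^ n))
    (hx : x ∈ (homoclinic α U).topologicalClosure) (k : ℤ) :
    (α ^ k) x ∈ (homoclinic α U).topologicalClosure :=
  map_mem_closure (hα k) hx fun _ hy => zpow_apply_mem_homoclinic hy k

theorem closure_homoclinic_le_plus_enlargement (hα : ∀ n : ℤ, Continuous (α ^ n)) :
    (homoclinic α W).topologicalClosure ≤ plus α (enlargement α W) := fun _ hx =>
  mem_plus.2 fun _ =>
    Subgroup.mem_sup_left (zpow_apply_mem_closure_homoclinic hα hx _)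

theorem plus_le_plus_enlargement : plus α W ≤ plus α (enlargement α W) :=
  plus_mono le_sup_right

/-- If `W = W₊W₋`, then every element of `W₊₊` in the enlargement of `W` is the product of a
homoclinic element and an element of `W₊`. -/
theorem exists_mul_eq_of_mem_expanding (hW : Factorizes α W) (hWo : IsOpen (W : Set G))
    (hN : (homoclinic α W).topologicalClosure ≤ Subgroup.normalizer (W : Set G))
    (hx : x ∈ expanding α W) (hxV : x ∈ enlargement α W) :
    ∃ l ∈ homoclinic α W, ∃ a ∈ plus α W, l * a = x := by
  rw [← SetLike.mem_coe, coe_enlargement hN] at hxV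
  obtain ⟨l, hl, w, hw, hlw⟩ := hxV
  -- Density: `l` is congruent modulo the open subgroup `W` to a homoclinic element `l'`.
  obtain ⟨l', hl'W, hl'⟩ := mem_closure_iff.1 (show l ∈ closure (homoclinic α W : Set G) from hl)
    {y | y⁻¹ * l ∈ W} (hWo.preimage (by fun_prop : Continuous fun y : G => y⁻¹ * l)) (by simp)
  have hu : l'⁻¹ * x ∈ W := by
    have := mul_mem hl'W hw
    rwa [mul_assoc, show l * w = x from hlw] at this
  obtain ⟨b, hb, a, ha, hba⟩ := hW.inv _ hu
  rw [inv_inv] at ha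
  have hxa : l' * b = x * a⁻¹ := by
    rw [eq_mul_inv_iff_mul_eq, mul_assoc, hba, mul_inv_cancel_left]
  refine ⟨l' * b, Subgroup.mem_inf.2 ⟨?_, ?_⟩, a, ha, by rw [hxa, inv_mul_cancel_right]⟩
  · rw [hxa]
    exact mul_mem hx (inv_mem (plus_le_expanding _ _ ha))
  · exact mul_mem hl'.2 (plus_le_expanding _ _ hb)

theorem factorizes_enlargement (hα : ∀ n : ℤ, Continuous (α ^ n)) (hW : Factorizes α W)
    (hN : (homoclinic α W).topologicalClosure ≤ Subgroup.normalizer (W : Set G)) :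
    Factorizes α (enlargement α W) := by
  intro x hx
  rw [← SetLike.mem_coe, coe_enlargement hN] at hx
  obtain ⟨l, hl, w, hw, rfl⟩ := hx
  obtain ⟨a, ha, b, hb, rfl⟩ := hW w hw
  refine ⟨l * a, mul_mem (closure_homoclinic_le_plus_enlargement hα hl)
    (plus_le_plus_enlargement ha), b, plus_mono le_sup_right hb, mul_assoc _ _ _⟩

variable [T2Space G]

/-- With `V = LW`, where `L` is the closure of the homoclinic group: `V₊ ⊆ LW₊`. After removing
factors from `L` and `W₊`, an element of `V₊` lies in `W₋`, and its backward orbit stays in `V`;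
it is then in `L αⁿ(W₋)` for every `n`, and `⋂ₙ αⁿ(W₋) ⊆ W₊`. -/
theorem exists_mul_eq_of_mem_plus_enlargement (hα : ∀ n : ℤ, Continuous (α ^ n))
    (hW : Factorizes α W) (hWc : IsCompact (W : Set G)) (hWo : IsOpen (W : Set G))
    (hN : (homoclinic α W).topologicalClosure ≤ Subgroup.normalizer (W : Set G))
    (hx : x ∈ plus α (enlargement α W)) :
    ∃ l ∈ (homoclinic α W).topologicalClosure, ∃ a ∈ plus α W, l * a = x := by
  have hxV := plus_le _ _ hx
  rw [← SetLike.mem_coe, coe_enlargement hN] at hxV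
  obtain ⟨l, hl, w, hw, rfl⟩ := hxV
  obtain ⟨b, hb, a, ha, rfl⟩ := hW.inv w hw
  rw [inv_inv] at ha
  have hbV : b ∈ plus α (enlargement α W) := by
    have := mul_mem (mul_mem (inv_mem (closure_homoclinic_le_plus_enlargement hα hl)) hx)
      (inv_mem (plus_le_plus_enlargement ha))
    simpa [mul_assoc] using this
  let C : ℕ → Set G := fun n => (α ^ (-(n : ℤ))) ⁻¹' (plus α⁻¹ W)
  have hanti : Antitone C := antitone_nat_of_succ_le fun n y hy => by
    have := zpow_apply_mem_plus_inv hy 1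
    rw [zpow_zpow_apply] at this
    change (α ^ (-(n : ℤ))) y ∈ plus α⁻¹ W
    convert this using 3
    push_cast; ring
  obtain ⟨m, hm, c, hc, rfl⟩ := exists_mul_eq_of_antitone (C := C) (x := b)
    (isCompact_closure_homoclinic hα hWc hWo) hanti
    (fun n => (isClosed_plus (continuous_zpow_inv hα) hWc.isClosed).preimage (hα _)) (fun n => by
      obtain ⟨l', hl', c, hc, h⟩ := exists_mul_eq_of_mem_expanding (α := α⁻¹)
        (x := (α ^ (-(n : ℤ))) b) hW.inv hWo (by rwa [homoclinic_inv])
        (by simpa only [inv_zpow', neg_neg] using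
          zpow_apply_mem_expanding (plus_le_expanding _ _ hb) (n : ℤ))
        (by rw [enlargement_inv]; exact mem_plus.1 hbV n)
      rw [homoclinic_inv] at hl'
      refine ⟨(α ^ (n : ℤ)) l', zpow_apply_mem_closure_homoclinic hα
        ((homoclinic α W).le_topologicalClosure hl') _, (α ^ (n : ℤ)) c, ?_, ?_⟩
      · change (α ^ (-(n : ℤ))) ((α ^ (n : ℤ)) c) ∈ plus α⁻¹ W
        rwa [zpow_zpow_apply, neg_add_cancel]
      · rw [← map_mul, h, zpow_zpow_apply, add_neg_cancel, zpow_zero, MulAut.one_apply])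
  refine ⟨l * m, mul_mem hl hm, c * a, mul_mem (mem_plus.2 fun n => ?_) ha, by simp [mul_assoc]⟩
  exact plus_le _ _ (hc n)

/-- With `V` the enlargement of `W`: `V₊₊ ∩ V ⊆ V₊`. -/
theorem expanding_enlargement_inf_le (hα : ∀ n : ℤ, Continuous (α ^ n))
    (hW : Factorizes α W) (hWc : IsCompact (W : Set G)) (hWo : IsOpen (W : Set G))
    (hN : (homoclinic α W).topologicalClosure ≤ Subgroup.normalizer (W : Set G)) :
    expanding α (enlargement α W) ⊓ enlargement α W ≤ plus α (enlargement α W) := by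
  rintro x ⟨hx, hxV⟩
  obtain ⟨n, hn⟩ := mem_expanding_iff_exists_plus.1 hx
  obtain ⟨l, hl, a, ha, hla⟩ := exists_mul_eq_of_mem_plus_enlargement hα hW hWc hWo hN hn
  have hl' := zpow_apply_mem_closure_homoclinic hα hl n
  have hxe : (α ^ (n : ℤ)) l * (α ^ (n : ℤ)) a = x := by
    rw [← map_mul, hla, zpow_zpow_apply, add_neg_cancel, zpow_zero, MulAut.one_apply]
  have haV : (α ^ (n : ℤ)) a ∈ enlargement α W := by
    rw [eq_inv_mul_iff_mul_eq.2 hxe]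
    exact mul_mem (inv_mem (Subgroup.mem_sup_left hl')) hxV
  obtain ⟨m, hm, c, hc, hmc⟩ := exists_mul_eq_of_mem_expanding hW hWo hN
    (zpow_apply_mem_expanding (plus_le_expanding _ _ ha) n) haV
  rw [← hxe, ← hmc]
  exact mul_mem (closure_homoclinic_le_plus_enlargement hα hl')
    (mul_mem (closure_homoclinic_le_plus_enlargement hα
      ((homoclinic α W).le_topologicalClosure hm)) (plus_le_plus_enlargement hc))

end Enlargement

/-! ### Tidiness below and the existence of tidy subgroups -/

/-- A subgroup that meets the open subgroup `U` in a closed set is closed, so `U₊₊` is closed as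
soon as `U₊₊ ∩ U = U₊`. -/
theorem isClosed_plusPlus_of_expanding_inf_le (hα : ∀ n : ℤ, Continuous (α ^ n))
    (hUo : IsOpen (U : Set G)) (h : expanding α U ⊓ U ≤ plus α U) :
    IsClosed (plusPlus α U) := by
  have hcl := isClosed_plus hα (Subgroup.isClosed_of_isOpen U hUo)
  rw [← coe_expanding]
  refine isClosed_of_closure_subset fun x hx => ?_
  obtain ⟨s, hsU, hs⟩ := mem_closure_iff.1 hx {y | y⁻¹ * x ∈ U}
    (hUo.preimage (by fun_prop : Continuous fun y : G => y⁻¹ * x)) (by simp)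
  have h1 : s⁻¹ * x ∈ closure (expanding α U : Set G) :=
    (expanding α U).topologicalClosure.mul_mem (inv_mem (subset_closure hs)) hx
  have h2 : s⁻¹ * x ∈ plus α U := by
    have h3 := closure_mono (show (expanding α U : Set G) ∩ U ⊆ plus α U from h)
      (inter_comm _ _ ▸ hUo.inter_closure ⟨hsU, h1⟩)
    rwa [hcl.closure_eq] at h3
  have := mul_mem hs (plus_le_expanding _ _ h2)
  rwa [mul_inv_cancel_left] at this

/-- If `W` is a compact open subgroup with `W = W₊W₋` that is normalized by the closure of
`W₊₊ ∩ W₋₋`, then the product of these two subgroups is tidy. -/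
theorem isTidy_enlargement [T2Space G] {W : Subgroup G} (hα : ∀ n : ℤ, Continuous (α ^ n))
    (hW : Factorizes α W) (hWc : IsCompact (W : Set G)) (hWo : IsOpen (W : Set G))
    (hN : (homoclinic α W).topologicalClosure ≤ Subgroup.normalizer (W : Set G)) :
    IsTidy α (enlargement α W) := by
  have hVo : IsOpen (enlargement α W : Set G) := Subgroup.isOpen_mono le_sup_right hWo
  refine ⟨?_, hVo, (factorizes_enlargement hα hW hN).isTidyAbove, ?_, ?_⟩
  · rw [coe_enlargement hN]
    exact (isCompact_closure_homoclinic hα hWc hWo).mul hWc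
  · exact isClosed_plusPlus_of_expanding_inf_le hα hVo
      (expanding_enlargement_inf_le hα hW hWc hWo hN)
  · rw [minusMinus_eq_plusPlus_inv]
    refine isClosed_plusPlus_of_expanding_inf_le (continuous_zpow_inv hα) hVo ?_
    rw [← enlargement_inv]
    exact expanding_enlargement_inf_le (continuous_zpow_inv hα) hW.inv hWc hWo
      (by rwa [homoclinic_inv])

/-- Every automorphism with continuous integer powers has a tidy subgroup. -/
theorem exists_isTidy [LocallyCompactSpace G] [TotallyDisconnectedSpace G] (α : MulAut G)
    (hα : ∀ n : ℤ, Continuous (α ^ n)) : ∃ V : Subgroup G, IsTidy α V := by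
  have : T2Space G := inferInstance
  obtain ⟨U, hUc, hUo⟩ := exists_compact_open_subgroup (G := G)
  obtain ⟨U', hU'U, hU'c, hU'o, hU'⟩ := exists_normalized_subgroup
    (isCompact_closure_homoclinic hα hUc hUo) hUc hUo
  obtain ⟨n, hn⟩ := exists_factorizes_truncation hα hU'c hU'o
  have hle := truncation_le α U' n
  refine ⟨_, isTidy_enlargement hα hn
    (hU'c.of_isClosed_subset (isClosed_truncation hα hU'c.isClosed n) hle)
    (isOpen_truncation hα hU'o n) fun l hl => ?_⟩
  -- The homoclinic group grows with the subgroup, so normalization by the larger compact group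
  -- `L` of `U` suffices.
  have hL : (homoclinic α (truncation α U' n)).topologicalClosure ≤
      (homoclinic α U).topologicalClosure :=
    closure_mono (homoclinic_mono (hle.trans hU'U))
  have hconj : ∀ l ∈ (homoclinic α U).topologicalClosure, ∀ x ∈ truncation α U' n,
      l * x * l⁻¹ ∈ truncation α U' n := fun l hl x hx => mem_truncation.2 fun k hk => by
    rw [map_mul, map_mul, map_inv]
    exact hU' _ (zpow_apply_mem_closure_homoclinic hα hl _) _ (mem_truncation.1 hx k hk)
  refine Subgroup.mem_normalizer_iff.2 fun x => ⟨hconj l (hL hl) x, fun h => ?_⟩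
  simpa [mul_assoc] using hconj _ (inv_mem (hL hl)) _ h

end Topology

end Tidy

theorem mainTheorem5 {G : Type*} [Group G] [TopologicalSpace G] [IsTopologicalGroup G]
    [LocallyCompactSpace G] [TotallyDisconnectedSpace G] (g : G) :
    ∃ U : Subgroup G, Tidy.IsTidy (MulAut.conj g) U := by
  refine Tidy.exists_isTidy (MulAut.conj g) fun n => ?_
  have : ⇑(MulAut.conj g ^ n) = fun x => g ^ n * x * (g ^ n)⁻¹ := by
    ext x
    rw [← map_zpow, MulAut.conj_apply]
  rw [this]
  fun_prop
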